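/- Let $m\ge 2$. Consider systems of $m$ third order ordinary differential equations $y_i'''=f^i(y'',y',y,x)$, $i=1,\dots,m$, where $f$ is smooth on an open set $U$ of second jets; in the coordinates $(x,y,p,q,r)$ on third jets, with $p=y'$, $q=y''$, $r=y'''$, such a system is the submanifold $\{(x,y,p,q)\in U,\ r=f(q,p,y,x)\}$. Let $\mathcal F$ be the family of those systems that have the form $$ f^i(q,p,y,x)=3q_i\sum_{j=1}^m A_j(p,y,x)\,q_j+\sum_{j=1}^m B^i_j(p,y,x)\,q_j+C^i(p,y,x),\qquad i=1,\dots,m, $$ on $U$, with coefficients $A_j$, $B^i_j$, $C^i$ that are smooth functions of $(p,y,x)$ on the projection of $U$ to first jets (and do not depend on $q$). Then $\mathcal F$ is invariant under the (pseudo)group of point transformations: let $\Phi(x,y)=(X(x,y),Y(x,y))$ be a smooth diffeomorphism between open subsets of $\mathbb R\times\mathbb R^m$ (for instance of the whole space), and prolong it to third jets by $$ P=\frac{dY/dx}{dX/dx},\qquad Q=\frac{dP/dx}{dX/dx},\qquad R=\frac{dQ/dx}{dX/dx}, $$ where $d/dx=\partial_x+\sum_i\left(p_i\,\partial_{y_i}+q_i\,\partial_{p_i}+r_i\,\partial_{q_i}\right)$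 is the total derivative, at the jets over the domain of $\Phi$ with $dX/dx\neq 0$. Then for every system in $\mathcal F$, the image, under the prolongation of $\Phi$, of the part of the system on which that prolongation is defined is again a system in $\mathcal F$. -/

import Mathlib

open scoped ContDiff

/-! Jets of curves `y = y(x)` in `ℝ × ℝ^m`, in the standard coordinates
`(x, y)`, `(x, y, p)`, `(x, y, p, q)`, `(x, y, p, q, r)` with `p = y'`, `q = y''`, `r = y'''`.
The first projection `j.1` is the canonical projection to the jets of one order less. -/

/-- The space of the independent variable `x` and the dependent variables `y`. -/
abbrev Jet0 (m : ℕ) : Type := ℝ × (Fin m → ℝ)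

/-- First jets `((x, y), p)`. -/
abbrev Jet1 (m : ℕ) : Type := Jet0 m × (Fin m → ℝ)

/-- Second jets `(((x, y), p), q)`. -/
abbrev Jet2 (m : ℕ) : Type := Jet1 m × (Fin m → ℝ)

/-- Third jets `((((x, y), p), q), r)`. -/
abbrev Jet3 (m : ℕ) : Type := Jet2 m × (Fin m → ℝ)

/-- A system of `m` ordinary differential equations of the third order, solved for the highest
derivatives, `y_i''' = f^i(y'', y', y, x)`, with smooth right hand side on an open set of
second jets. -/
structure ThirdOrderSystem (m : ℕ) where
  /-- The set of second jets on which the right hand side is given. -/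
  domain : Set (Jet2 m)
  isOpen_domain : IsOpen domain
  /-- The right hand side (its values off `domain` play no role). -/
  rhs : Jet2 m → Fin m → ℝ
  smooth_rhs : ContDiffOn ℝ ∞ rhs domain

/-- The submanifold `r = f(x, y, p, q)` of the third jet space defined by a system. -/
def ThirdOrderSystem.equation {m : ℕ} (S : ThirdOrderSystem m) : Set (Jet3 m) :=
  {j | j.1 ∈ S.domain ∧ j.2 = S.rhs j.1}

/-- The right hand side has the form
`f^i = 3 q_i ∑_j A_j q_j + ∑_j B^i_j q_j + C^i`, where the coefficients `A_j`, `B^i_j`, `C^i` are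
smooth functions of `(x, y, p)` only. -/
def ThirdOrderSystem.HasSpecialForm {m : ℕ} (S : ThirdOrderSystem m) : Prop :=
  ∃ (A : Jet1 m → Fin m → ℝ) (B : Jet1 m → Fin m → Fin m → ℝ) (C : Jet1 m → Fin m → ℝ),
    ContDiffOn ℝ ∞ A (Prod.fst '' S.domain) ∧
    ContDiffOn ℝ ∞ B (Prod.fst '' S.domain) ∧
    ContDiffOn ℝ ∞ C (Prod.fst '' S.domain) ∧
    ∀ j ∈ S.domain, ∀ i : Fin m,
      S.rhs j i = 3 * j.2 i * (∑ k, A j.1 k * j.2 k) + (∑ k, B j.1 i k * j.2 k) + C j.1 i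

/-- The family of all equations (as submanifolds of the third jet space) of the special form. -/
def specialFamily (m : ℕ) : Set (Set (Jet3 m)) :=
  {E | ∃ S : ThirdOrderSystem m, S.HasSpecialForm ∧ E = S.equation}

/-- The vector `∂_x + p ∂_y`: differentiation along it is the total derivative `d/dx` of functions
of `(x, y)`. -/
def totalVector1 {m : ℕ} (j : Jet1 m) : Jet0 m := (1, j.2)

/-- The vector `∂_x + p ∂_y + q ∂_p`. -/
def totalVector2 {m : ℕ} (j : Jet2 m) : Jet1 m := (totalVector1 j.1, j.2)

/-- The vector `∂_x + p ∂_y + q ∂_p + r ∂_q`. -/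
def totalVector3 {m : ℕ} (j : Jet3 m) : Jet2 m := (totalVector2 j.1, j.2)

/-- A point transformation `(x, y) ↦ (X(x, y), Y(x, y))`: a smooth diffeomorphism between open
subsets of `ℝ × ℝ^m` (possibly all of it). -/
structure PointTransformation (m : ℕ) extends OpenPartialHomeomorph (Jet0 m) (Jet0 m) where
  smooth_toFun : ContDiffOn ℝ ∞ toFun source
  smooth_invFun : ContDiffOn ℝ ∞ invFun target

namespace PointTransformation

/-- The total derivative `dX/dx` of the new independent variable. -/
noncomputable def dX {m : ℕ} (Φ : PointTransformation m) (j : Jet1 m) : ℝ :=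
  fderiv ℝ (fun z : Jet0 m => (Φ.toFun z).1) j.1 (totalVector1 j)

/-- The new first derivatives `P = dY/dX = (dY/dx) / (dX/dx)`. -/
noncomputable def newP {m : ℕ} (Φ : PointTransformation m) (j : Jet1 m) : Fin m → ℝ :=
  (Φ.dX j)⁻¹ • fderiv ℝ (fun z : Jet0 m => (Φ.toFun z).2) j.1 (totalVector1 j)

/-- The new second derivatives `Q = dP/dX = (dP/dx) / (dX/dx)`. -/
noncomputable def newQ {m : ℕ} (Φ : PointTransformation m) (j : Jet2 m) : Fin m → ℝ :=
  (Φ.dX j.1)⁻¹ • fderiv ℝ Φ.newP j.1 (totalVector2 j)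

/-- The new third derivatives `R = dQ/dX = (dQ/dx) / (dX/dx)`. -/
noncomputable def newR {m : ℕ} (Φ : PointTransformation m) (j : Jet3 m) : Fin m → ℝ :=
  (Φ.dX j.1.1)⁻¹ • fderiv ℝ Φ.newQ j.1 (totalVector3 j)

/-- The third jets on which the prolongation is defined: the base point lies in the domain of the
transformation, and the image of a curve with this jet is again, near the image point, a graph over
the new independent variable, that is, `dX/dx ≠ 0`. -/
def prolongationDomain {m : ℕ} (Φ : PointTransformation m) : Set (Jet3 m) :=
  {j | j.1.1.1 ∈ Φ.source ∧ Φ.dX j.1.1 ≠ 0}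

/-- The prolongation of a point transformation to third jets. -/
noncomputable def prolongation {m : ℕ} (Φ : PointTransformation m) (j : Jet3 m) : Jet3 m :=
  (((Φ.toFun j.1.1.1, Φ.newP j.1.1), Φ.newQ j.1), Φ.newR j)

/-- The image of an equation under (the prolongation of) a point transformation. -/
def mapEquation {m : ℕ} (Φ : PointTransformation m) (E : Set (Jet3 m)) : Set (Jet3 m) :=
  Φ.prolongation '' (E ∩ Φ.prolongationDomain)

end PointTransformation

/-! Write `D = dX/dx` and `ξ = X_y`. The second prolongation is affine in `q`: `Q = N + K q`, with
`N`, `K` functions of first jets. The quotient rule for `P` gives `K q = D⁻³ w`, where `w` is a 2×2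
determinant in the images of `(1, p)` and `(0, q)`, so `w` is unchanged under `p ↦ p + t q`.
Differentiating `K q` in `p` along `q` therefore acts only on `D⁻³` and yields `-3 D⁻¹ ξ(q) K q`
(`fderiv_newQLin_apply`): the part of `dQ/dx` quadratic in `q` is a scalar multiple of `K q`
(`newR_eq`). Substituting `r = 3 a(q) q + b q + c` keeps this shape: the quadratic part of `R` is `3
l(q) K q` with `l = D⁻¹ (a - D⁻¹ ξ)`. Replacing `K q` by `Q - N`, and `q` by the affine function of
`Q` given by the inverse transformation, produces the special form again. -/

namespace ThirdOrderSystem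

/-- The special form, with coefficients that are linear maps instead of coordinate arrays. -/
theorem hasSpecialForm_iff {m : ℕ} (S : ThirdOrderSystem m) :
    S.HasSpecialForm ↔ ∃ (a : Jet1 m → (Fin m → ℝ) →L[ℝ] ℝ)
      (b : Jet1 m → (Fin m → ℝ) →L[ℝ] (Fin m → ℝ)) (c : Jet1 m → Fin m → ℝ),
      ContDiffOn ℝ ∞ a (Prod.fst '' S.domain) ∧ ContDiffOn ℝ ∞ b (Prod.fst '' S.domain) ∧
      ContDiffOn ℝ ∞ c (Prod.fst '' S.domain) ∧
      ∀ j ∈ S.domain, S.rhs j = (3 * a j.1 j.2) • j.2 + b j.1 j.2 + c j.1 := by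
  constructor
  · rintro ⟨A, B, C, hA, hB, hC, h⟩
    refine ⟨fun z => ∑ k, A z k • ContinuousLinearMap.proj (R := ℝ) (φ := fun _ : Fin m => ℝ) k,
      fun z => ∑ i, ∑ k, B z i k • (ContinuousLinearMap.single ℝ (fun _ : Fin m => ℝ) i).comp
        (ContinuousLinearMap.proj (R := ℝ) (φ := fun _ : Fin m => ℝ) k), C, ?_, ?_, hC, ?_⟩
    · exact ContDiffOn.sum fun k _ => (contDiffOn_pi.1 hA k).smul contDiffOn_const
    · exact ContDiffOn.sum fun i _ => ContDiffOn.sum fun k _ =>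
        (contDiffOn_pi.1 (contDiffOn_pi.1 hB i) k).smul contDiffOn_const
    · intro j hj
      ext i
      rw [h j hj i]
      simp only [_root_.sum_apply, smul_apply,
        ContinuousLinearMap.proj_apply, ContinuousLinearMap.comp_apply, Pi.add_apply,
        Pi.smul_apply, Finset.sum_apply, ContinuousLinearMap.single_apply, smul_eq_mul]
      congr 2
      · ring
      · simp [Pi.single_apply, Finset.sum_ite_irrel]
  · rintro ⟨a, b, c, ha, hb, hc, h⟩
    have expand (q : Fin m → ℝ) : q = ∑ k, q k • (Pi.single k 1 : Fin m → ℝ) :=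
      pi_eq_sum_univ' q
    refine ⟨fun z k => a z (Pi.single k 1), fun z i k => b z (Pi.single k 1) i, c, ?_, ?_, hc, ?_⟩
    · exact contDiffOn_pi.2 fun k => ha.clm_apply contDiffOn_const
    · exact contDiffOn_pi.2 fun i => contDiffOn_pi.2 fun k =>
        contDiffOn_pi.1 (hb.clm_apply contDiffOn_const) i
    · intro j hj i
      have h1 : a j.1 j.2 = ∑ k, a j.1 (Pi.single k 1) * j.2 k := by
        conv_lhs => rw [expand j.2]
        simp [map_sum, mul_comm]
      have h2 : b j.1 j.2 i = ∑ k, b j.1 (Pi.single k 1) i * j.2 k := by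
        conv_lhs => rw [expand j.2]
        simp [map_sum, mul_comm]
      rw [h j hj, ← h1, ← h2]
      simp only [Pi.add_apply, Pi.smul_apply, smul_eq_mul]
      ring

end ThirdOrderSystem

/-! ### Smoothness of the prolongations -/

theorem contDiff_totalVector1 {m : ℕ} : ContDiff ℝ ∞ (totalVector1 (m := m)) :=
  contDiff_const.prodMk contDiff_snd

theorem contDiff_totalVector2 {m : ℕ} : ContDiff ℝ ∞ (totalVector2 (m := m)) :=
  (contDiff_totalVector1.comp contDiff_fst).prodMk contDiff_snd

theorem contDiff_totalVector3 {m : ℕ} : ContDiff ℝ ∞ (totalVector3 (m := m)) :=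
  (contDiff_totalVector2.comp contDiff_fst).prodMk contDiff_snd

namespace PointTransformation

variable {m : ℕ} (Φ : PointTransformation m)

/-- The inverse point transformation. -/
def symm : PointTransformation m where
  toOpenPartialHomeomorph := Φ.toOpenPartialHomeomorph.symm
  smooth_toFun := Φ.smooth_invFun
  smooth_invFun := Φ.smooth_toFun

/-- The first jets on which the prolongation is defined. -/
def domain1 : Set (Jet1 m) := {j | j.1 ∈ Φ.source ∧ Φ.dX j ≠ 0}

/-- The second jets on which the prolongation is defined. -/
def domain2 : Set (Jet2 m) := Prod.fst ⁻¹' Φ.domain1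

/-- The prolongation to first jets. -/
noncomputable def prolong1 (j : Jet1 m) : Jet1 m := (Φ.toFun j.1, Φ.newP j)

/-- The prolongation to second jets. -/
noncomputable def prolong2 (j : Jet2 m) : Jet2 m := (Φ.prolong1 j.1, Φ.newQ j)

theorem contDiffOn_dX : ContDiffOn ℝ ∞ Φ.dX (Prod.fst ⁻¹' Φ.source) :=
  ((Φ.smooth_toFun.fst.fderiv_of_isOpen Φ.open_source le_rfl).comp contDiff_fst.contDiffOn
    fun _ h => h).clm_apply contDiff_totalVector1.contDiffOn

theorem isOpen_domain1 : IsOpen Φ.domain1 :=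
  Φ.contDiffOn_dX.continuousOn.isOpen_inter_preimage (Φ.open_source.preimage continuous_fst)
    isOpen_ne

theorem isOpen_domain2 : IsOpen Φ.domain2 := Φ.isOpen_domain1.preimage continuous_fst

theorem contDiffOn_dX_inv : ContDiffOn ℝ ∞ (fun j => (Φ.dX j)⁻¹) Φ.domain1 :=
  (Φ.contDiffOn_dX.mono fun _ h => h.1).inv fun _ h => h.2

theorem contDiffOn_newP : ContDiffOn ℝ ∞ Φ.newP Φ.domain1 :=
  Φ.contDiffOn_dX_inv.smul
    (((Φ.smooth_toFun.snd.fderiv_of_isOpen Φ.open_source le_rfl).comp contDiff_fst.contDiffOn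
      fun _ h => h.1).clm_apply contDiff_totalVector1.contDiffOn)

theorem contDiffOn_fderiv_newP : ContDiffOn ℝ ∞ (fderiv ℝ Φ.newP) Φ.domain1 :=
  Φ.contDiffOn_newP.fderiv_of_isOpen Φ.isOpen_domain1 le_rfl

theorem contDiffOn_newQ : ContDiffOn ℝ ∞ Φ.newQ Φ.domain2 :=
  (Φ.contDiffOn_dX_inv.comp contDiff_fst.contDiffOn fun _ h => h).smul
    ((Φ.contDiffOn_fderiv_newP.comp contDiff_fst.contDiffOn fun _ h => h).clm_apply
      contDiff_totalVector2.contDiffOn)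

theorem contDiffOn_newR : ContDiffOn ℝ ∞ Φ.newR (Prod.fst ⁻¹' Φ.domain2) :=
  (Φ.contDiffOn_dX_inv.comp (contDiff_fst.comp contDiff_fst).contDiffOn fun _ h => h).smul
    (((Φ.contDiffOn_newQ.fderiv_of_isOpen Φ.isOpen_domain2 le_rfl).comp contDiff_fst.contDiffOn
      fun _ h => h).clm_apply contDiff_totalVector3.contDiffOn)

theorem contDiffOn_prolong1 : ContDiffOn ℝ ∞ Φ.prolong1 Φ.domain1 :=
  (Φ.smooth_toFun.comp contDiff_fst.contDiffOn fun _ h => h.1).prodMk Φ.contDiffOn_newP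

theorem contDiffOn_prolong2 : ContDiffOn ℝ ∞ Φ.prolong2 Φ.domain2 :=
  (Φ.contDiffOn_prolong1.comp contDiff_fst.contDiffOn fun _ h => h).prodMk Φ.contDiffOn_newQ

theorem differentiableAt_toFun {z : Jet0 m} (hz : z ∈ Φ.source) :
    DifferentiableAt ℝ Φ.toFun z :=
  (Φ.smooth_toFun.contDiffAt (Φ.open_source.mem_nhds hz)).differentiableAt (by simp)

theorem differentiableAt_newP {j : Jet1 m} (hj : j ∈ Φ.domain1) :
    DifferentiableAt ℝ Φ.newP j :=
  (Φ.contDiffOn_newP.contDiffAt (Φ.isOpen_domain1.mem_nhds hj)).differentiableAt (by simp)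

/-! ### The prolongations are inverted by those of the inverse transformation -/

/-- The division by `dX/dx` in `newP` is exactly what makes the differential preserve the total
direction, up to the factor `dX/dx`. -/
theorem fderiv_toFun_totalVector1 {j : Jet1 m} (hj : j ∈ Φ.domain1) :
    fderiv ℝ Φ.toFun j.1 (totalVector1 j) = Φ.dX j • totalVector1 (Φ.prolong1 j) := by
  have hd := Φ.differentiableAt_toFun hj.1
  refine Prod.ext ?_ ?_
  · simp only [totalVector1, Prod.smul_fst, smul_eq_mul, mul_one, dX]
    rw [fderiv.fst hd]
    rfl
  · simp only [totalVector1, prolong1, newP, Prod.smul_snd]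
    rw [smul_inv_smul₀ hj.2, fderiv.snd hd]
    rfl

theorem fderiv_prolong1_totalVector2 {j : Jet2 m} (hj : j ∈ Φ.domain2) :
    fderiv ℝ Φ.prolong1 j.1 (totalVector2 j) = Φ.dX j.1 • totalVector2 (Φ.prolong2 j) := by
  have hd := Φ.differentiableAt_toFun hj.1
  have h1 : HasFDerivAt Φ.prolong1 (((fderiv ℝ Φ.toFun j.1.1).comp
      (ContinuousLinearMap.fst ℝ (Jet0 m) (Fin m → ℝ))).prod (fderiv ℝ Φ.newP j.1)) j.1 :=
    (hd.hasFDerivAt.comp j.1 hasFDerivAt_fst).prodMk (Φ.differentiableAt_newP hj).hasFDerivAt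
  rw [h1.fderiv]
  refine Prod.ext (Φ.fderiv_toFun_totalVector1 hj) ?_
  simp only [totalVector2, prolong2, newQ, Prod.smul_snd]
  rw [smul_inv_smul₀ hj.2]
  rfl

theorem symm_toFun_toFun {z : Jet0 m} (hz : z ∈ Φ.source) : Φ.symm.toFun (Φ.toFun z) = z :=
  Φ.left_inv' hz

/-- Chain rule for `Φ⁻¹ ∘ Φ = id` along the total vector. -/
theorem fderiv_symm_totalVector1 {j : Jet1 m} (hj : j ∈ Φ.domain1) :
    fderiv ℝ Φ.symm.toFun (Φ.toFun j.1) (totalVector1 (Φ.prolong1 j)) =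
      (Φ.dX j)⁻¹ • totalVector1 j := by
  have h0 : Φ.toFun j.1 ∈ Φ.symm.source := Φ.map_source' hj.1
  have h1 := (Φ.symm.differentiableAt_toFun h0).hasFDerivAt.comp j.1
    (Φ.differentiableAt_toFun hj.1).hasFDerivAt
  have h2 : HasFDerivAt (Φ.symm.toFun ∘ Φ.toFun) (ContinuousLinearMap.id ℝ (Jet0 m)) j.1 :=
    (hasFDerivAt_id j.1).congr_of_eventuallyEq
      (Filter.eventually_of_mem (Φ.open_source.mem_nhds hj.1) fun _ h => Φ.symm_toFun_toFun h)
  have h3 := DFunLike.congr_fun (h1.unique h2) (totalVector1 j)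
  rw [ContinuousLinearMap.comp_apply, Φ.fderiv_toFun_totalVector1 hj, map_smul] at h3
  rw [eq_inv_smul_iff₀ hj.2]
  exact h3

theorem symm_dX_prolong1 {j : Jet1 m} (hj : j ∈ Φ.domain1) :
    Φ.symm.dX (Φ.prolong1 j) = (Φ.dX j)⁻¹ := by
  have h0 : Φ.toFun j.1 ∈ Φ.symm.source := Φ.map_source' hj.1
  have h := congrArg Prod.fst (Φ.fderiv_symm_totalVector1 hj)
  simp only [totalVector1, Prod.smul_fst, smul_eq_mul, mul_one] at h
  rw [← h, dX]
  change fderiv ℝ _ (Φ.toFun j.1) _ = _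
  rw [fderiv.fst (Φ.symm.differentiableAt_toFun h0)]
  rfl

theorem mapsTo_prolong1 : Set.MapsTo Φ.prolong1 Φ.domain1 Φ.symm.domain1 := fun _ hj =>
  ⟨Φ.map_source' hj.1, by rw [Φ.symm_dX_prolong1 hj]; exact inv_ne_zero hj.2⟩

/-- The differential of `Φ⁻¹` on the total vector is computed in two ways; cancelling the common
factor `(dX/dx)⁻¹` identifies the `p` components. -/
theorem symm_prolong1_prolong1 {j : Jet1 m} (hj : j ∈ Φ.domain1) :
    Φ.symm.prolong1 (Φ.prolong1 j) = j := by
  refine Prod.ext (Φ.symm_toFun_toFun hj.1) ?_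
  have h := (Φ.symm.fderiv_toFun_totalVector1 (Φ.mapsTo_prolong1 hj)).symm.trans
    (Φ.fderiv_symm_totalVector1 hj)
  rw [Φ.symm_dX_prolong1 hj] at h
  rw [smul_right_inj (inv_ne_zero hj.2)] at h
  exact congrArg (Prod.snd : Jet0 m → Fin m → ℝ) h

theorem mapsTo_prolong2 : Set.MapsTo Φ.prolong2 Φ.domain2 Φ.symm.domain2 := fun _ hj =>
  Φ.mapsTo_prolong1 hj

theorem differentiableAt_prolong1 {j : Jet1 m} (hj : j ∈ Φ.domain1) :
    DifferentiableAt ℝ Φ.prolong1 j :=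
  (Φ.contDiffOn_prolong1.contDiffAt (Φ.isOpen_domain1.mem_nhds hj)).differentiableAt (by simp)

/-- The argument of `symm_prolong1_prolong1`, one order higher. -/
theorem symm_prolong2_prolong2 {j : Jet2 m} (hj : j ∈ Φ.domain2) :
    Φ.symm.prolong2 (Φ.prolong2 j) = j := by
  have h1 := (Φ.symm.differentiableAt_prolong1 (Φ.mapsTo_prolong1 hj)).hasFDerivAt.comp j.1
    (Φ.differentiableAt_prolong1 hj).hasFDerivAt
  have h2 : HasFDerivAt (Φ.symm.prolong1 ∘ Φ.prolong1) (ContinuousLinearMap.id ℝ (Jet1 m)) j.1 :=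
    (hasFDerivAt_id j.1).congr_of_eventuallyEq
      (Filter.eventually_of_mem (Φ.isOpen_domain1.mem_nhds hj)
        fun _ h => Φ.symm_prolong1_prolong1 h)
  have h3 := DFunLike.congr_fun (h1.unique h2) (totalVector2 j)
  rw [ContinuousLinearMap.comp_apply, Φ.fderiv_prolong1_totalVector2 hj, map_smul] at h3
  have h4 := Φ.symm.fderiv_prolong1_totalVector2 (Φ.mapsTo_prolong2 hj)
  change fderiv ℝ Φ.symm.prolong1 (Φ.prolong1 j.1) _ = Φ.symm.dX (Φ.prolong1 j.1) • _ at h4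
  rw [h4, Φ.symm_dX_prolong1 hj, smul_inv_smul₀ hj.2] at h3
  exact Prod.ext (Φ.symm_prolong1_prolong1 hj)
    (congrArg (Prod.snd : Jet1 m → Fin m → ℝ) h3)

/-! ### Dependence of `Q` on `q` -/

/-- The part `N(x, y, p)` of `Q = N + K q` of order zero in `q`. -/
noncomputable def newQConst (j : Jet1 m) : Fin m → ℝ :=
  (Φ.dX j)⁻¹ • fderiv ℝ Φ.newP j (totalVector1 j, 0)

/-- The coefficient `K(x, y, p)` of `q` in `Q = N + K q`. -/
noncomputable def newQLin (j : Jet1 m) : (Fin m → ℝ) →L[ℝ] (Fin m → ℝ) :=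
  (Φ.dX j)⁻¹ • (fderiv ℝ Φ.newP j).comp (ContinuousLinearMap.inr ℝ (Jet0 m) (Fin m → ℝ))

/-- The partial derivative `X_y`. -/
noncomputable def dXdy (j : Jet1 m) : (Fin m → ℝ) →L[ℝ] ℝ :=
  (fderiv ℝ (fun z : Jet0 m => (Φ.toFun z).1) j.1).comp
    (ContinuousLinearMap.inr ℝ ℝ (Fin m → ℝ))

theorem newQ_eq (j : Jet2 m) : Φ.newQ j = Φ.newQConst j.1 + Φ.newQLin j.1 j.2 := by
  have h : totalVector2 j = (totalVector1 j.1, 0) + (0, j.2) := by simp [totalVector2]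
  rw [newQ, h, map_add, smul_add]
  rfl

theorem contDiffOn_newQConst : ContDiffOn ℝ ∞ Φ.newQConst Φ.domain1 :=
  Φ.contDiffOn_dX_inv.smul (Φ.contDiffOn_fderiv_newP.clm_apply
    (contDiff_totalVector1.prodMk contDiff_const).contDiffOn)

theorem contDiffOn_newQLin : ContDiffOn ℝ ∞ Φ.newQLin Φ.domain1 :=
  Φ.contDiffOn_dX_inv.smul (Φ.contDiffOn_fderiv_newP.clm_comp contDiffOn_const)

theorem contDiffOn_dXdy : ContDiffOn ℝ ∞ Φ.dXdy Φ.domain1 :=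
  ((Φ.smooth_toFun.fst.fderiv_of_isOpen Φ.open_source le_rfl).comp contDiff_fst.contDiffOn
    fun _ h => h.1).clm_comp contDiffOn_const

theorem dX_add (z : Jet0 m) (p q : Fin m → ℝ) (t : ℝ) :
    Φ.dX (z, p + t • q) = Φ.dX (z, p) + t * Φ.dXdy (z, p) q := by
  have h : totalVector1 (z, p + t • q) = totalVector1 (z, p) + t • ((0, q) : Jet0 m) := by
    simp [totalVector1]
  simp only [dX, h, map_add, map_smul, smul_eq_mul]
  rfl

/-- The numerator of `K q = (dX/dx)⁻³ w`; it depends on `p` only modulo `q`. -/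
noncomputable def newQNumerator (z : Jet0 m) (p q : Fin m → ℝ) : Fin m → ℝ :=
  Φ.dX (z, p) • fderiv ℝ (fun z : Jet0 m => (Φ.toFun z).2) z (0, q) -
    Φ.dXdy (z, p) q • fderiv ℝ (fun z : Jet0 m => (Φ.toFun z).2) z (totalVector1 (z, p))

/-- A determinant does not change when a multiple of one column is added to the other. -/
theorem newQNumerator_add (z : Jet0 m) (p q : Fin m → ℝ) (t : ℝ) :
    Φ.newQNumerator z (p + t • q) q = Φ.newQNumerator z p q := by
  have h : totalVector1 (z, p + t • q) = totalVector1 (z, p) + t • ((0, q) : Jet0 m) := by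
    simp [totalVector1]
  have h' : Φ.dXdy (z, p + t • q) = Φ.dXdy (z, p) := rfl
  simp only [newQNumerator, dX_add, h, h', map_add, map_smul]
  module

theorem hasDerivAt_line (z : Jet0 m) (p q : Fin m → ℝ) :
    HasDerivAt (fun t : ℝ => ((z, p + t • q) : Jet1 m)) (0, q) 0 := by
  have h := ((hasDerivAt_id (0 : ℝ)).smul_const q).const_add p
  simp only [one_smul] at h
  exact (hasDerivAt_const 0 z).prodMk h

theorem newQLin_apply {z : Jet0 m} {p : Fin m → ℝ} (h : (z, p) ∈ Φ.domain1) (q : Fin m → ℝ) :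
    Φ.newQLin (z, p) q = (Φ.dX (z, p) ^ 3)⁻¹ • Φ.newQNumerator z p q := by
  have h0 : Φ.dX (z, p) ≠ 0 := h.2
  have h1 : HasDerivAt (fun t : ℝ => Φ.newP (z, p + t • q)) (fderiv ℝ Φ.newP (z, p) (0, q)) 0 :=
    HasFDerivAt.comp_hasDerivAt_of_eq 0 (Φ.differentiableAt_newP h).hasFDerivAt
      (hasDerivAt_line z p q) (by simp)
  have h2 : HasDerivAt (fun t : ℝ => Φ.newP (z, p + t • q))
      ((Φ.dX (z, p) ^ 2)⁻¹ • Φ.newQNumerator z p q) 0 := by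
    -- Along the line, `P` is a quotient of affine functions of `t`.
    have e : (fun t : ℝ => Φ.newP (z, p + t • q)) = fun t : ℝ =>
        (Φ.dX (z, p) + t * Φ.dXdy (z, p) q)⁻¹ •
          (fderiv ℝ (fun z : Jet0 m => (Φ.toFun z).2) z (totalVector1 (z, p)) +
            t • fderiv ℝ (fun z : Jet0 m => (Φ.toFun z).2) z (0, q)) := by
      funext t
      have h : totalVector1 (z, p + t • q) = totalVector1 (z, p) + t • ((0, q) : Jet0 m) := by
        simp [totalVector1]
      rw [newP, dX_add, h, map_add, map_smul]
    rw [e]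
    have d1 := (((hasDerivAt_id (0 : ℝ)).mul_const (Φ.dXdy (z, p) q)).const_add
      (Φ.dX (z, p))).fun_inv (by simpa using h0)
    have d2 := ((hasDerivAt_id (0 : ℝ)).smul_const
      (fderiv ℝ (fun z : Jet0 m => (Φ.toFun z).2) z (0, q))).const_add
        (fderiv ℝ (fun z : Jet0 m => (Φ.toFun z).2) z (totalVector1 (z, p)))
    refine (d1.fun_smul d2).congr_deriv ?_
    simp only [id, zero_mul, add_zero, zero_smul, one_smul, one_mul, newQNumerator]
    match_scalars <;> field_simp
  change (Φ.dX (z, p))⁻¹ • fderiv ℝ Φ.newP (z, p) (0, q) = _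
  rw [h1.unique h2, smul_smul]
  congr 1
  field_simp

theorem differentiableAt_newQLin {j : Jet1 m} (hj : j ∈ Φ.domain1) :
    DifferentiableAt ℝ Φ.newQLin j :=
  (Φ.contDiffOn_newQLin.contDiffAt (Φ.isOpen_domain1.mem_nhds hj)).differentiableAt (by simp)

theorem differentiableAt_newQConst {j : Jet1 m} (hj : j ∈ Φ.domain1) :
    DifferentiableAt ℝ Φ.newQConst j :=
  (Φ.contDiffOn_newQConst.contDiffAt (Φ.isOpen_domain1.mem_nhds hj)).differentiableAt (by simp)

/-- The part of `dQ/dx` that is quadratic in `q` is a multiple of `K q`. -/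
theorem fderiv_newQLin_apply {j : Jet1 m} (hj : j ∈ Φ.domain1) (q : Fin m → ℝ) :
    fderiv ℝ Φ.newQLin j (0, q) q =
      (-3 * (Φ.dX j)⁻¹ * Φ.dXdy j q) • Φ.newQLin j q := by
  obtain ⟨z, p⟩ := j
  have h0 : Φ.dX (z, p) ≠ 0 := hj.2
  have h1 : HasDerivAt (fun t : ℝ => Φ.newQLin (z, p + t • q))
      (fderiv ℝ Φ.newQLin (z, p) (0, q)) 0 :=
    HasFDerivAt.comp_hasDerivAt_of_eq 0 (Φ.differentiableAt_newQLin hj).hasFDerivAt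
      (hasDerivAt_line z p q) (by simp)
  have h2 : HasDerivAt (fun t : ℝ => Φ.newQLin (z, p + t • q) q)
      (fderiv ℝ Φ.newQLin (z, p) (0, q) q) 0 := by
    simpa using h1.clm_apply (hasDerivAt_const 0 q)
  -- The numerator is constant along the line, so only the cube of `dX/dx` varies; the formula is
  -- available only near `t = 0`, where `dX/dx ≠ 0`.
  have h3 : (fun t : ℝ => Φ.newQLin (z, p + t • q) q) =ᶠ[nhds 0] fun t =>
      ((Φ.dX (z, p) + t * Φ.dXdy (z, p) q) ^ 3)⁻¹ • Φ.newQNumerator z p q := by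
    have hc : Filter.Tendsto (fun t : ℝ => ((z, p + t • q) : Jet1 m)) (nhds 0)
        (nhds (z, p)) := by
      simpa using (hasDerivAt_line z p q).continuousAt.tendsto
    filter_upwards [hc.eventually (Φ.isOpen_domain1.mem_nhds hj)] with t ht
    rw [Φ.newQLin_apply ht, dX_add, newQNumerator_add]
  have d1 := (((((hasDerivAt_id (0 : ℝ)).mul_const (Φ.dXdy (z, p) q)).const_add
    (Φ.dX (z, p))).fun_pow 3).fun_inv (by simpa using h0)).smul_const (Φ.newQNumerator z p q)
  rw [h2.unique (d1.congr_of_eventuallyEq h3), Φ.newQLin_apply hj, smul_smul]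
  congr 1
  simp only [id, zero_mul, add_zero, one_mul]
  push_cast
  field_simp

/-! ### Dependence of `R` on `q` and `r` -/

/-- The part of `dQ/dx` of order zero in `q`, `r`. -/
noncomputable def newRConst (j : Jet1 m) : Fin m → ℝ :=
  fderiv ℝ Φ.newQConst j (totalVector1 j, 0)

/-- The coefficient of the part of `dQ/dx` that is linear in `q` and free of `r`. -/
noncomputable def newRLin (j : Jet1 m) : (Fin m → ℝ) →L[ℝ] (Fin m → ℝ) :=
  (fderiv ℝ Φ.newQConst j).comp (ContinuousLinearMap.inr ℝ (Jet0 m) (Fin m → ℝ)) +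
    fderiv ℝ Φ.newQLin j (totalVector1 j, 0)

theorem contDiffOn_newRConst : ContDiffOn ℝ ∞ Φ.newRConst Φ.domain1 :=
  (Φ.contDiffOn_newQConst.fderiv_of_isOpen Φ.isOpen_domain1 le_rfl).clm_apply
    (contDiff_totalVector1.prodMk contDiff_const).contDiffOn

theorem contDiffOn_newRLin : ContDiffOn ℝ ∞ Φ.newRLin Φ.domain1 :=
  ((Φ.contDiffOn_newQConst.fderiv_of_isOpen Φ.isOpen_domain1 le_rfl).clm_comp
    contDiffOn_const).add
  ((Φ.contDiffOn_newQLin.fderiv_of_isOpen Φ.isOpen_domain1 le_rfl).clm_apply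
    (contDiff_totalVector1.prodMk contDiff_const).contDiffOn)

/-- Product rule for `Q = N + K q`; the only quadratic term, `dK(0, q) q`, is rewritten by
`fderiv_newQLin_apply`. -/
theorem newR_eq {j : Jet2 m} (hj : j ∈ Φ.domain2) (r : Fin m → ℝ) :
    Φ.newR (j, r) = (Φ.dX j.1)⁻¹ • (Φ.newQLin j.1 r +
      (-3 * (Φ.dX j.1)⁻¹ * Φ.dXdy j.1 j.2) • Φ.newQLin j.1 j.2 +
      Φ.newRLin j.1 j.2 + Φ.newRConst j.1) := by
  have hN := (Φ.differentiableAt_newQConst hj).hasFDerivAt.comp j hasFDerivAt_fst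
  have hK := ((Φ.differentiableAt_newQLin hj).hasFDerivAt.comp j hasFDerivAt_fst).clm_apply
    (hasFDerivAt_snd (p := j))
  have hQ := (hN.add hK).congr_of_eventuallyEq (Filter.Eventually.of_forall Φ.newQ_eq)
  have h : totalVector2 j = (totalVector1 j.1, 0) + (0, j.2) := by simp [totalVector2]
  rw [newR, hQ.fderiv, ← Φ.fderiv_newQLin_apply hj]
  simp only [totalVector3, add_apply, ContinuousLinearMap.comp_apply,
    ContinuousLinearMap.flip_apply, ContinuousLinearMap.coe_fst', ContinuousLinearMap.coe_snd',
    h, map_add, newRLin, newRConst, ContinuousLinearMap.inr_apply, Function.comp_apply]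
  congr 1
  abel

/-! ### The image system and its special form -/

/-- The image of a system under a point transformation, as a system. -/
noncomputable def mapSystem (S : ThirdOrderSystem m) : ThirdOrderSystem m where
  domain := Φ.symm.domain2 ∩ Φ.symm.prolong2 ⁻¹' S.domain
  isOpen_domain := Φ.symm.contDiffOn_prolong2.continuousOn.isOpen_inter_preimage
    Φ.symm.isOpen_domain2 S.isOpen_domain
  rhs J := Φ.newR (Φ.symm.prolong2 J, S.rhs (Φ.symm.prolong2 J))
  smooth_rhs := by
    have h := Φ.symm.contDiffOn_prolong2.mono
      (Set.inter_subset_left (t := Φ.symm.prolong2 ⁻¹' S.domain))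
    exact Φ.contDiffOn_newR.comp (h.prodMk (S.smooth_rhs.comp h fun _ hJ => hJ.2))
      fun _ hJ => Φ.symm.mapsTo_prolong2 hJ.1

/-- Inverting the prolongation on second jets suffices, since on the equation `r` is determined by
the second jet. -/
theorem mapEquation_equation (S : ThirdOrderSystem m) :
    Φ.mapEquation S.equation = (Φ.mapSystem S).equation := by
  ext J
  constructor
  · rintro ⟨j, ⟨⟨hj, hr⟩, hd⟩, rfl⟩
    have e : Φ.symm.prolong2 (Φ.prolong2 j.1) = j.1 := Φ.symm_prolong2_prolong2 hd
    refine ⟨⟨Φ.mapsTo_prolong2 hd, ?_⟩, ?_⟩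
    · change Φ.symm.prolong2 (Φ.prolong2 j.1) ∈ S.domain
      rwa [e]
    · change Φ.newR j = Φ.newR (Φ.symm.prolong2 (Φ.prolong2 j.1),
        S.rhs (Φ.symm.prolong2 (Φ.prolong2 j.1)))
      rw [e, ← hr]
  · rintro ⟨⟨h1, h2⟩, h3⟩
    refine ⟨(Φ.symm.prolong2 J.1, S.rhs (Φ.symm.prolong2 J.1)),
      ⟨⟨h2, rfl⟩, Φ.symm.mapsTo_prolong2 h1⟩, ?_⟩
    exact Prod.ext (Φ.symm.symm_prolong2_prolong2 h1) h3.symm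

theorem hasSpecialForm_mapSystem {S : ThirdOrderSystem m} (hS : S.HasSpecialForm) :
    (Φ.mapSystem S).HasSpecialForm := by
  obtain ⟨a, b, c, ha, hb, hc, h⟩ := S.hasSpecialForm_iff.1 hS
  set Ψ := Φ.symm with hΨ
  set s := Prod.fst '' (Φ.mapSystem S).domain with hs
  have hs1 : s ⊆ Ψ.domain1 := by
    rintro _ ⟨J, hJ, rfl⟩
    exact hJ.1
  have hsd : Set.MapsTo Ψ.prolong1 s Φ.domain1 := fun J hJ => Ψ.mapsTo_prolong1 (hs1 hJ)
  have hsS : Set.MapsTo Ψ.prolong1 s (Prod.fst '' S.domain) := by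
    rintro _ ⟨J, hJ, rfl⟩
    exact ⟨Ψ.prolong2 J, hJ.2, rfl⟩
  have hP := Ψ.contDiffOn_prolong1.mono hs1
  replace ha := ha.comp hP hsS
  replace hb := hb.comp hP hsS
  replace hc := hc.comp hP hsS
  have hd := Φ.contDiffOn_dX_inv.comp hP hsd
  have hξ := Φ.contDiffOn_dXdy.comp hP hsd
  have hN := Φ.contDiffOn_newQConst.comp hP hsd
  have hK := Φ.contDiffOn_newQLin.comp hP hsd
  have hL := Φ.contDiffOn_newRLin.comp hP hsd
  have hC := Φ.contDiffOn_newRConst.comp hP hsd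
  have hα := Ψ.contDiffOn_newQLin.mono hs1
  have hβ := Ψ.contDiffOn_newQConst.mono hs1
  -- `R = 3 l(q) Q + k(q) + d`, where `q = α Q + β`
  let l : Jet1 m → (Fin m → ℝ) →L[ℝ] ℝ := fun J => (Φ.dX (Ψ.prolong1 J))⁻¹ •
    (a (Ψ.prolong1 J) - (Φ.dX (Ψ.prolong1 J))⁻¹ • Φ.dXdy (Ψ.prolong1 J))
  -- The subtracted term comes from replacing `K q` by `Q - N` in `3 l(q) K q`.
  let k : Jet1 m → (Fin m → ℝ) →L[ℝ] (Fin m → ℝ) := fun J =>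
    (Φ.dX (Ψ.prolong1 J))⁻¹ • ((Φ.newQLin (Ψ.prolong1 J)).comp (b (Ψ.prolong1 J)) +
      Φ.newRLin (Ψ.prolong1 J)) -
    (3 : ℝ) • (l J).smulRight (Φ.newQConst (Ψ.prolong1 J))
  let d : Jet1 m → Fin m → ℝ := fun J => (Φ.dX (Ψ.prolong1 J))⁻¹ •
    (Φ.newQLin (Ψ.prolong1 J) (c (Ψ.prolong1 J)) + Φ.newRConst (Ψ.prolong1 J))
  have hl : ContDiffOn ℝ ∞ l s := hd.smul (ha.sub (hd.smul hξ))
  have hk : ContDiffOn ℝ ∞ k s :=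
    (hd.smul ((hK.clm_comp hb).add hL)).sub ((hl.smulRight hN).const_smul 3)
  have hd' : ContDiffOn ℝ ∞ d s := hd.smul ((hK.clm_apply hc).add hC)
  -- Expansion of `3 l(αQ + β) Q + k(αQ + β) + d` by degree in `Q`: the summand `3 l(β) Q` is linear
  -- and joins the second coefficient.
  refine (ThirdOrderSystem.hasSpecialForm_iff _).2
    ⟨fun J => (l J).comp (Ψ.newQLin J),
      fun J => (3 * l J (Ψ.newQConst J)) • ContinuousLinearMap.id ℝ (Fin m → ℝ) +
        (k J).comp (Ψ.newQLin J),
      fun J => k J (Ψ.newQConst J) + d J,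
      hl.clm_comp hα,
      ((contDiffOn_const.mul (hl.clm_apply hβ)).smul contDiffOn_const).add (hk.clm_comp hα),
      (hk.clm_apply hβ).add hd', ?_⟩
  intro J hJ
  have hj : Ψ.prolong2 J ∈ Φ.domain2 := Ψ.mapsTo_prolong2 hJ.1
  have hQ : J.2 = Φ.newQConst (Ψ.prolong1 J.1) + Φ.newQLin (Ψ.prolong1 J.1) (Ψ.newQ J) :=
    (congrArg Prod.snd (Ψ.symm_prolong2_prolong2 hJ.1)).symm.trans (Φ.newQ_eq _)
  have hR : (Φ.mapSystem S).rhs J =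
      (3 * l J.1 (Ψ.newQ J)) • J.2 + k J.1 (Ψ.newQ J) + d J.1 := by
    change Φ.newR (Ψ.prolong2 J, S.rhs (Ψ.prolong2 J)) = _
    rw [Φ.newR_eq hj, h _ hJ.2, hQ]
    simp only [l, k, d, prolong2, map_add, map_smul, sub_apply,
      add_apply, smul_apply,
      ContinuousLinearMap.comp_apply, ContinuousLinearMap.smulRight_apply, smul_eq_mul]
    module
  rw [hR, Ψ.newQ_eq]
  simp only [map_add, add_apply, smul_apply,
    ContinuousLinearMap.comp_apply, ContinuousLinearMap.id_apply]
  module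

end PointTransformation

theorem mainTheorem10 (m : ℕ) (hm : 2 ≤ m) (Φ : PointTransformation m) (E : Set (Jet3 m))
    (hE : E ∈ specialFamily m) : Φ.mapEquation E ∈ specialFamily m := by
  obtain ⟨S, hS, rfl⟩ := hE
  exact ⟨Φ.mapSystem S, Φ.hasSpecialForm_mapSystem hS, Φ.mapEquation_equation S⟩
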